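/- Let $X$ be an infinite set of cardinality $\kappa$, and let $X^X$ be the monoid of all maps $X\to X$ under composition. Call a submonoid of $X^X$ precomplete if it is a dual atom (a maximal proper element) of the lattice of submonoids of $X^X$, and symmetric if it contains $\gamma^{-1}\circ f\circ\gamma$ whenever it contains $f$ and $\gamma$ is a permutation of $X$. Call $S\subseteq X$ small if $|S|<\kappa$, and say that a property holds for almost all $x\in X$ if it holds for all $x$ in some set with small complement. For a cardinal $\lambda$, call $f\in X^X$ $\lambda$-injective if there is $A\subseteq X$ with $|A|<\lambda$ such that $f$ is injective on $X\setminus A$, and $\lambda$-surjective if $|X\setminus f[X]|<\lambda$. Put $$\mathscr A=\{f: f^{-1}[\{y\}]\text{ is small for almost all }y\in X\},$$ $$\mathscr A'=\{f: \text{there is a cardinal }\lambda<\kappa\text{ such that }|f^{-1}[\{y\}]|\le\lambda\text{ for almost all }y\in X\},$$ $$\mathscr G_\lambda=\{f: \text{if }A\subseteq X\text{ has cardinality }\lambda\text{, then }|X\setminus f[X\setminus A]|\ge\lambda\},$$ $$\mathscr M_\lambda=\{f: f\text{ is }\lambda\text{-surjective or not }\lambda\text{-injective}\}.$$ Then the symmetric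 precomplete submonoids of $X^X$ are exactly the precomplete submonoids of $X^X$ that contain all permutations of $X$. They are exactly the following: the monoid $\mathscr A$ if $\kappa$ is regular, or the monoid $\mathscr A'$ if $\kappa$ is singular, together with the monoids $\mathscr G_\lambda$ and $\mathscr M_\lambda$, where $\lambda$ runs over $1$ and all cardinals with $\aleph_0\le\lambda\le\kappa$. -/

import Mathlib

open Cardinal

/-- The conjugate `γ⁻¹ ∘ f ∘ γ` of a self-map `f` of `X` by a permutation `γ`. -/
def conjFun {X : Type*} (γ : Equiv.Perm X) (f : Function.End X) : Function.End X :=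
  fun x => γ.symm (f (γ x))

/-- A set of self-maps of `X` is symmetric if it is closed under conjugation by permutations. -/
def IsSymmetric {X : Type*} (S : Set (Function.End X)) : Prop :=
  ∀ (γ : Equiv.Perm X), ∀ f ∈ S, conjFun γ f ∈ S

/-- The set of all permutations of `X`, as a subset of the full transformation monoid. -/
def permSet (X : Type*) : Set (Function.End X) :=
  {f | Function.Bijective f}

/-- A set of self-maps of `X` is a precomplete monoid if it is (the underlying set of) a dual atom
in the lattice of submonoids of the full transformation monoid of `X`. -/
def IsPrecompleteMonoid {X : Type*} (S : Set (Function.End X)) : Prop :=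
  ∃ G : Submonoid (Function.End X), (G : Set (Function.End X)) = S ∧ IsCoatom G

/-- A subset of `X` is small if its cardinality is less than that of `X`. -/
def IsSmall {X : Type*} (S : Set X) : Prop :=
  #S < #X

/-- A property holds for almost all `x : X` if it holds on a set with small complement. -/
def AlmostAll {X : Type*} (p : X → Prop) : Prop :=
  ∃ S : Set X, IsSmall Sᶜ ∧ ∀ x ∈ S, p x

/-- `f` is `c`-injective if it is injective off a set of cardinality less than `c`. -/
def IsCardInjective {X : Type*} (c : Cardinal) (f : Function.End X) : Prop :=
  ∃ A : Set X, #A < c ∧ Set.InjOn f Aᶜ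

/-- `f` is `c`-surjective if it misses fewer than `c` points. -/
def IsCardSurjective {X : Type*} (c : Cardinal) (f : Function.End X) : Prop :=
  #((Set.range f)ᶜ : Set X) < c

/-- `𝒜`: almost all fibres are small. -/
def setA (X : Type*) : Set (Function.End X) :=
  {f | AlmostAll fun y => IsSmall (f ⁻¹' {y})}

/-- `𝒜'`: almost all fibres have cardinality bounded by one fixed cardinal below `#X`. -/
def setA' (X : Type*) : Set (Function.End X) :=
  {f | ∃ c < #X, AlmostAll fun y => #(f ⁻¹' {y} : Set X) ≤ c}

/-- `𝒢_c`: deleting `c` points from the domain leaves at least `c` points outside the image. -/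
def setG (X : Type*) (c : Cardinal) : Set (Function.End X) :=
  {f | ∀ A : Set X, #A = c → c ≤ #((f '' Aᶜ)ᶜ : Set X)}

/-- `ℳ_c`: the maps that are `c`-surjective or not `c`-injective. -/
def setM (X : Type*) (c : Cardinal) : Set (Function.End X) :=
  {f | IsCardSurjective c f ∨ ¬ IsCardInjective c f}

/-- The list of monoids `𝒢_c`, `ℳ_c` for `c = 1` and `ℵ₀ ≤ c ≤ #X`, together with `𝒜` if `#X` is
a regular cardinal and with `𝒜'` if it is singular. -/
def IsListed {X : Type*} (S : Set (Function.End X)) : Prop :=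
  ((#X).IsRegular ∧ S = setA X) ∨
  ((#X).IsSingular ∧ S = setA' X) ∨
  ∃ c : Cardinal, (c = 1 ∨ (ℵ₀ ≤ c ∧ c ≤ #X)) ∧ (S = setG X c ∨ S = setM X c)

/-!
Write `κ` for the cardinality of `X`. The heart of the matter is that a submonoid `H` that contains
all permutations and is contained in no listed set contains every map
(`eq_top_of_not_subset_isListed`).

* From maps outside the `ℳ_c`, induction on `c` produces injections in `H` missing `c` points, for
  all `c ≤ κ` (`exists_injective_mem`). Two injections missing `κ` points differ by a permutation,
  so all of them belong to `H`.
* Dually, from maps outside the `𝒢_c` one obtains a map `f ∈ H` and a set `A` of size `κ` such that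
  `f` maps the complement of `A` onto `X` (`exists_surjective_mem`).
* If `h ∈ H` has `κ` fibres of size `κ`, an arbitrary map factors as an injection missing `κ`
  points, `h`, a permutation and `f` (`mem_of_not_subset_setA`). A map outside `𝒜` is such an `h`.
  If `κ` is singular and `h` is only outside `𝒜'`, its fibres are large enough for some
  `h ∘ e ∘ h` to be outside `𝒜`: glue together fewer than `κ` fibres whose sizes are cofinal in `κ`
  (`exists_not_mem_setA`).

The listed sets are proper submonoids containing all permutations, and they are pairwise
incomparable (`IsListed.eq_of_subset`). Hence they are exactly the coatoms containing all
permutations.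

A submonoid containing all permutations is symmetric. Conversely, let `G` be a symmetric coatom. For
every involution `s` and permutation `τ` the product `s * (τ * s * τ⁻¹)` lies in `G`
(`mul_conj_mem_of_isSymmetric`), because `G` together with `s` generates all maps and so has, as it
were, index at most two. A swindle on `ℤ × Y` writes every permutation with `κ` fixed points as a
product of two such elements, and every permutation is a product of two permutations with `κ` fixed
points (`permSet_subset_of_isSymmetric`).
-/

universe u

/-! ### Cardinal arithmetic in an infinite set -/

/-- The form in which `Cardinal.extend_function` is used: two injections of the same type whose
ranges have equally large complements differ by a bijection. -/
theorem exists_equiv_comp_eq {T : Type*} {X Y : Type u} (f : T → X) (g : T → Y)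
    (hf : Function.Injective f) (hg : Function.Injective g)
    (h : #((Set.range f)ᶜ : Set X) = #((Set.range g)ᶜ : Set Y)) :
    ∃ e : X ≃ Y, ∀ t, e (f t) = g t := by
  let i : Set.range f ↪ Y :=
    ⟨fun x => g ((Equiv.ofInjective f hf).symm x),
      hg.comp (Equiv.ofInjective f hf).symm.injective⟩
  have hr : Set.range i = Set.range g := by
    ext y
    constructor
    · rintro ⟨x, rfl⟩
      exact ⟨_, rfl⟩
    · rintro ⟨t, rfl⟩
      exact ⟨Equiv.ofInjective f hf t, by simp [i]⟩
  obtain ⟨e, he⟩ := extend_function i (by rw [hr]; exact Cardinal.eq.1 h)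
  refine ⟨e, fun t => ?_⟩
  have := he (Equiv.ofInjective f hf t)
  simpa [i] using this

theorem exists_perm_image_eq {X : Type u} {A B : Set X} (h : #A = #B)
    (h' : #(Aᶜ : Set X) = #(Bᶜ : Set X)) : ∃ e : Equiv.Perm X, e '' A = B := by
  obtain ⟨i⟩ := Cardinal.eq.1 h
  obtain ⟨e, he⟩ := exists_equiv_comp_eq (fun a : A => (a : X)) (fun a : A => (i a : X))
    Subtype.val_injective (Subtype.val_injective.comp i.injective) (by
      have : Set.range (fun a : A => (i a : X)) = B := by
        ext y
        constructor
        · rintro ⟨t, rfl⟩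
          exact (i t).2
        · intro hy
          exact ⟨i.symm ⟨y, hy⟩, by simp⟩
      rw [this]
      simpa using h')
  refine ⟨e, ?_⟩
  ext y
  constructor
  · rintro ⟨x, hx, rfl⟩
    rw [he ⟨x, hx⟩]
    exact (i _).2
  · intro hy
    exact ⟨i.symm ⟨y, hy⟩, (i.symm _).2, by rw [he]; simp⟩

theorem mk_eq_of_not_isSmall {X : Type u} {S : Set X} (h : ¬ IsSmall S) : #S = #X :=
  le_antisymm (mk_set_le S) (not_lt.1 h)

theorem almostAll_iff {X : Type u} {p : X → Prop} : AlmostAll p ↔ IsSmall {x | ¬ p x} := by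
  constructor
  · rintro ⟨S, hS, h⟩
    exact (mk_le_mk_of_subset fun x (hx : ¬ p x) hxS => hx (h x hxS)).trans_lt hS
  · intro h
    exact ⟨{x | p x}, h, fun _ hx => hx⟩

/-- Unions of two sets with fewer than `c` points have fewer than `c` points, also for `c = 1`. -/
theorem mk_union_lt_of_infinite_or_one {c : Cardinal.{u}} (hc : c = 1 ∨ ℵ₀ ≤ c) {X : Type u}
    {A B : Set X} (hA : #A < c) (hB : #B < c) : #(A ∪ B : Set X) < c := by
  rcases hc with rfl | hc
  · rw [Cardinal.lt_one_iff, Cardinal.mk_set_eq_zero_iff] at *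
    simp [hA, hB]
  · exact (mk_union_le A B).trans_lt (add_lt_of_lt hc hA hB)

section
variable {X : Type u} [Infinite X]

/-- An infinite set splits into two equipotent copies of itself. -/
theorem exists_sumEquiv (X : Type u) [Infinite X] : Nonempty (X ≃ X ⊕ X) := by
  refine Cardinal.eq.1 ?_
  simp [add_eq_self (aleph0_le_mk X)]

theorem exists_prodEquiv (X : Type u) [Infinite X] : Nonempty (X ≃ X × X) := by
  refine Cardinal.eq.1 ?_
  simp [mul_eq_self (aleph0_le_mk X)]

theorem exists_set_mk_eq {c : Cardinal.{u}} (hc : c ≤ #X) :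
    ∃ A : Set X, #A = c ∧ #(Aᶜ : Set X) = #X := by
  obtain ⟨e⟩ := exists_sumEquiv X
  obtain ⟨A, rfl⟩ := le_mk_iff_exists_set.1 hc
  have hi : Function.Injective fun x => e.symm (Sum.inl x) :=
    e.symm.injective.comp Sum.inl_injective
  refine ⟨(fun x => e.symm (Sum.inl x)) '' A, mk_image_eq hi, le_antisymm (mk_set_le _) ?_⟩
  refine mk_le_of_injective (f := fun x => ⟨e.symm (Sum.inr x), ?_⟩) ?_
  · rintro ⟨y, -, hy⟩
    simp at hy
  · intro x y h
    simpa using h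

theorem exists_injective_mk_compl_range_eq {c : Cardinal.{u}} (hc : c ≤ #X) :
    ∃ f : X → X, Function.Injective f ∧ #((Set.range f)ᶜ : Set X) = c := by
  obtain ⟨A, hA, hA'⟩ := exists_set_mk_eq hc
  obtain ⟨e⟩ := Cardinal.eq.1 hA'.symm
  refine ⟨fun x => e x, Subtype.val_injective.comp e.injective, ?_⟩
  have : Set.range (fun x => (e x : X)) = Aᶜ := by
    ext y
    constructor
    · rintro ⟨t, rfl⟩
      exact (e t).2
    · intro hy
      exact ⟨e.symm ⟨y, hy⟩, by simp⟩
  rw [this, compl_compl, hA]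

theorem exists_subset_mk_eq {S : Set X} (hS : #S = #X) :
    ∃ T ⊆ S, #T = #X ∧ #(S \ T : Set X) = #X := by
  have : Infinite S := by rw [infinite_iff, hS]; exact aleph0_le_mk X
  obtain ⟨A, hA, hA'⟩ := exists_set_mk_eq (le_refl #S)
  refine ⟨Subtype.val '' A, by simp, ?_, ?_⟩
  · rw [mk_image_eq Subtype.val_injective, hA, hS]
  · have : S \ (Subtype.val '' A) = Subtype.val '' (Aᶜ) := by
      ext x
      simp
    rw [this, mk_image_eq Subtype.val_injective, hA', hS]

theorem exists_injective_range_subset {S : Set X} (hS : #S = #X) :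
    ∃ b : X → X, Function.Injective b ∧ (∀ x, b x ∈ S) ∧ #(S \ Set.range b : Set X) = #X := by
  obtain ⟨T, hT, hT', hT''⟩ := exists_subset_mk_eq hS
  obtain ⟨e⟩ := Cardinal.eq.1 hT'.symm
  refine ⟨fun x => e x, Subtype.val_injective.comp e.injective, fun x => hT (e x).2, ?_⟩
  refine le_antisymm (mk_set_le _) (hT''.symm.le.trans (mk_le_mk_of_subset ?_))
  refine Set.sdiff_subset_sdiff_right ?_
  rintro _ ⟨x, rfl⟩
  exact (e x).2

end

/-- A family of at most `#X` subsets of `X`, each of full cardinality, has a system of distinct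
representatives: choose the points by recursion along a well-order of minimal type. -/
theorem exists_injective_choice {X T : Type u} (hT : #T ≤ #X) (B : T → Set X)
    (hB : ∀ t, #(B t) = #X) : ∃ y : T → X, Function.Injective y ∧ ∀ t, y t ∈ B t := by
  obtain ⟨r, hr, ho⟩ := exists_ord_eq T
  have key : ∀ (t : T) (F : ∀ s, r s t → X), ∃ x ∈ B t, ∀ s hs, F s hs ≠ x := by
    intro t F
    by_contra! hcon
    have : B t ⊆ Set.range fun s : {s // r s t} => F s.1 s.2 := by
      intro x hx
      obtain ⟨s, hs, h⟩ := hcon x hx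
      exact ⟨⟨s, hs⟩, h⟩
    have h1 := (mk_le_mk_of_subset this).trans mk_range_le
    rw [hB] at h1
    have h2 : #{s // r s t} < #T := by
      rw [← Ordinal.card_typein]
      exact card_typein_lt t ho
    exact absurd (h1.trans_lt h2) (not_lt.2 hT)
  choose x hx hne using key
  let y : T → X := hr.wf.fix x
  have hy : ∀ t, y t = x t fun s _ => y s := fun t => hr.wf.fix_eq x t
  refine ⟨y, ?_, fun t => by rw [hy]; exact hx _ _⟩
  have hlt : ∀ s t, r s t → y s ≠ y t := fun s t hst => by
    rw [hy t]
    exact hne t (fun s _ => y s) s hst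
  intro s t hst
  by_contra hcon
  rcases (trichotomous_of r s t) with h | h | h
  · exact hlt _ _ h hst
  · exact hcon h
  · exact hlt _ _ h hst.symm

/-- A singular cardinal `c` has a cofinal family of fewer than `c` smaller cardinals. -/
theorem exists_cofinal_family {c : Cardinal.{u}} (hc : c.IsSingular) :
    ∃ (ι : Type u) (l : ι → Cardinal.{u}), #ι < c ∧ (∀ i, l i < c) ∧ ∀ d < c, ∃ i, d ≤ l i := by
  induction c using Cardinal.inductionOn with | mk α
  obtain ⟨_, _, ho⟩ := exists_ord_eq_type_lt α
  obtain ⟨S, hS, hS'⟩ := Order.exists_cof_eq α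
  refine ⟨S, fun s => #(Set.Iio s.1), ?_, fun s => mk_Iio_lt s.1 ho, fun d hd => ?_⟩
  · rw [hS', ← Ordinal.cof_type, ← ho]
    exact hc.cof_ord_lt
  · obtain ⟨x, hx⟩ := Ordinal.typein_surj (α := α) (· < ·) (o := d.ord)
      (by rw [← ho]; exact ord_lt_ord.2 hd)
    obtain ⟨s, hs, hxs⟩ := hS x
    refine ⟨⟨s, hs⟩, ?_⟩
    have hd : #(Set.Iio x) = d := by
      have := congrArg Ordinal.card hx
      rwa [Ordinal.card_typein, card_ord] at this
    rw [← hd]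
    exact mk_le_mk_of_subset (Set.Iio_subset_Iio hxs)

/-! ### The listed sets are submonoids containing all permutations -/

section
variable {X : Type u}

/-- The indices `c` for which `𝒢_c` and `ℳ_c` are listed. -/
def IsListedIndex (X : Type u) (c : Cardinal.{u}) : Prop :=
  c = 1 ∨ (ℵ₀ ≤ c ∧ c ≤ #X)

theorem IsListedIndex.one_or_infinite {c : Cardinal.{u}} (hc : IsListedIndex X c) :
    c = 1 ∨ ℵ₀ ≤ c :=
  hc.imp_right And.left

theorem IsListedIndex.one_le {c : Cardinal.{u}} (hc : IsListedIndex X c) : 1 ≤ c := by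
  rcases hc with rfl | hc
  · exact le_rfl
  · exact one_lt_aleph0.le.trans hc.1

theorem IsListedIndex.le_mk [Infinite X] {c : Cardinal.{u}} (hc : IsListedIndex X c) :
    c ≤ #X := by
  rcases hc with rfl | hc
  · exact one_lt_aleph0.le.trans (aleph0_le_mk X)
  · exact hc.2

theorem mul_mem_setG {c : Cardinal.{u}} {f g : Function.End X} (hf : f ∈ setG X c)
    (hg : g ∈ setG X c) : f * g ∈ setG X c := by
  intro A hA
  obtain ⟨B, hB, hBc⟩ := le_mk_iff_exists_subset.1 (hg A hA)
  refine (hf B hBc).trans (mk_le_mk_of_subset (Set.compl_subset_compl.2 ?_))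
  rintro _ ⟨x, hx, rfl⟩
  exact ⟨g x, fun h => hB h ⟨x, hx, rfl⟩, rfl⟩

theorem mul_mem_setM {c : Cardinal.{u}} (hc : c = 1 ∨ ℵ₀ ≤ c) {f g : Function.End X}
    (hf : f ∈ setM X c) (hg : g ∈ setM X c) : f * g ∈ setM X c := by
  by_cases hfg : IsCardInjective c (f * g)
  swap
  · exact Or.inr hfg
  left
  obtain ⟨A, hA, hinj⟩ := hfg
  have hg' : IsCardSurjective c g :=
    hg.resolve_right fun h => h ⟨A, hA, fun x hx y hy h => hinj hx hy (congrArg f h)⟩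
  have hf' : IsCardSurjective c f := by
    refine hf.resolve_right fun h => h ⟨(Set.range g)ᶜ ∪ g '' A, ?_, ?_⟩
    · exact mk_union_lt_of_infinite_or_one hc hg' (mk_image_le.trans_lt hA)
    · intro x hx y hy hxy
      simp only [Set.compl_union, compl_compl, Set.mem_inter_iff, Set.mem_compl_iff] at hx hy
      obtain ⟨⟨x, rfl⟩, hx⟩ := hx
      obtain ⟨⟨y, rfl⟩, hy⟩ := hy
      rw [hinj (fun h => hx ⟨x, h, rfl⟩) (fun h => hy ⟨y, h, rfl⟩) hxy]
  refine (mk_le_mk_of_subset ?_).trans_lt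
    (mk_union_lt_of_infinite_or_one hc hf' ((mk_image_le (f := f)).trans_lt hg'))
  intro y hy
  by_cases h : y ∈ Set.range f
  · obtain ⟨x, rfl⟩ := h
    exact Or.inr ⟨x, fun ⟨z, hz⟩ => hy ⟨z, congrArg f hz⟩, rfl⟩
  · exact Or.inl h

theorem fiber_mul (f g : Function.End X) (y : X) :
    (f * g) ⁻¹' {y} = ⋃ z : ↥(f ⁻¹' {y}), g ⁻¹' {z.1} := by
  ext x
  rw [Set.mem_iUnion]
  exact ⟨fun h => ⟨⟨g x, h⟩, rfl⟩, fun ⟨z, hz⟩ => (congrArg f hz).trans z.2⟩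

/-- If the fibres of `f` and `g` are tame outside small sets of points, then for all but a small
set of `y` both the fibre of `f` at `y` and those of `g` at its points are tame. -/
theorem AlmostAll.fiber_comp [Infinite X] {p q : X → Prop} (hp : AlmostAll p) (hq : AlmostAll q)
    (f : X → X) : AlmostAll fun y => p y ∧ ∀ x, f x = y → q x := by
  rw [almostAll_iff] at *
  have h : IsSmall ({y | ¬ p y} ∪ f '' {x | ¬ q x}) :=
    mk_union_lt_of_infinite_or_one (Or.inr (aleph0_le_mk X)) hp (mk_image_le.trans_lt hq)
  refine (mk_le_mk_of_subset ?_).trans_lt h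
  intro y hy
  by_contra hcon
  rw [Set.mem_union, not_or] at hcon
  refine hy ⟨not_not.1 hcon.1, fun x hx => ?_⟩
  by_contra hqx
  exact hcon.2 ⟨x, hqx, hx⟩

theorem AlmostAll.mono {p q : X → Prop} (hp : AlmostAll p) (h : ∀ x, p x → q x) :
    AlmostAll q :=
  let ⟨S, hS, hpS⟩ := hp
  ⟨S, hS, fun x hx => h x (hpS x hx)⟩

theorem mul_mem_setA [Infinite X] (hreg : (#X).IsRegular) {f g : Function.End X}
    (hf : f ∈ setA X) (hg : g ∈ setA X) : f * g ∈ setA X := by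
  refine (AlmostAll.fiber_comp hf hg f).mono fun y ⟨h1, h2⟩ => ?_
  rw [IsSmall, fiber_mul, card_iUnion_lt_iff_forall_of_isRegular hreg h1]
  exact fun z => h2 z.1 z.2

theorem mul_mem_setA' [Infinite X] {f g : Function.End X}
    (hf : f ∈ setA' X) (hg : g ∈ setA' X) : f * g ∈ setA' X := by
  obtain ⟨c, hc, hf⟩ := hf
  obtain ⟨d, hd, hg⟩ := hg
  refine ⟨c * d, mul_lt_of_lt (aleph0_le_mk X) hc hd,
    (AlmostAll.fiber_comp hf hg f).mono fun y ⟨h1, h2⟩ => ?_⟩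
  rw [fiber_mul]
  refine (mk_iUnion_le _).trans (mul_le_mul' h1 (ciSup_le' fun z => h2 z.1 z.2))

theorem setA'_subset_setA : setA' X ⊆ setA X := by
  rintro f ⟨c, hc, hf⟩
  exact hf.mono fun y hy => hy.trans_lt hc

theorem mem_setA'_of_fiber_le [Infinite X] {f : Function.End X} (n : ℕ)
    (hf : ∀ y, #(f ⁻¹' {y} : Set X) ≤ n) : f ∈ setA' X :=
  ⟨n, (natCast_lt_aleph0).trans_le (aleph0_le_mk X), Set.univ,
    by simp [IsSmall, pos_iff_ne_zero], fun y _ => hf y⟩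

theorem mem_setA'_of_injective [Infinite X] {f : Function.End X} (hf : Function.Injective f) :
    f ∈ setA' X := by
  refine mem_setA'_of_fiber_le 1 fun y => ?_
  rw [Nat.cast_one, le_one_iff_subsingleton]
  exact ⟨fun a b => Subtype.ext (hf (a.2.trans b.2.symm))⟩

theorem permSet_subset_setG (c : Cardinal.{u}) : permSet X ⊆ setG X c := by
  intro f hf A hA
  rw [← Set.image_compl_eq hf, compl_compl, mk_image_eq hf.1, hA]

theorem mem_setM_of_surjective {c : Cardinal.{u}} (hc : 1 ≤ c) {f : Function.End X}
    (hf : Function.Surjective f) : f ∈ setM X c := by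
  left
  rw [IsCardSurjective, hf.range_eq, Set.compl_univ, mk_eq_zero]
  exact zero_lt_one.trans_le hc

theorem IsListed.permSet_subset [Infinite X] {S : Set (Function.End X)} (h : IsListed S) :
    permSet X ⊆ S := by
  rcases h with ⟨-, rfl⟩ | ⟨-, rfl⟩ | ⟨c, hc, rfl | rfl⟩
  · exact fun f hf => setA'_subset_setA (mem_setA'_of_injective hf.1)
  · exact fun f hf => mem_setA'_of_injective hf.1
  · exact permSet_subset_setG c
  · exact fun f hf => mem_setM_of_surjective (IsListedIndex.one_le hc) hf.2

theorem one_mem_permSet : (1 : Function.End X) ∈ permSet X := Function.bijective_id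

theorem IsListed.exists_submonoid [Infinite X] {S : Set (Function.End X)} (h : IsListed S) :
    ∃ H : Submonoid (Function.End X), (H : Set (Function.End X)) = S := by
  have h1 : 1 ∈ S := h.permSet_subset one_mem_permSet
  refine ⟨⟨⟨S, fun {f g} hf hg => ?_⟩, h1⟩, rfl⟩
  rcases h with ⟨hreg, rfl⟩ | ⟨-, rfl⟩ | ⟨c, hc, rfl | rfl⟩
  · exact mul_mem_setA hreg hf hg
  · exact mul_mem_setA' hf hg
  · exact mul_mem_setG hf hg
  · exact mul_mem_setM (IsListedIndex.one_or_infinite hc) hf hg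

end

/-! ### The listed sets are pairwise incomparable -/

section
variable {X : Type u}

theorem not_mem_setA {f : Function.End X} {S : Set X} (hS : #S = #X)
    (h : ∀ y ∈ S, #X ≤ #(f ⁻¹' {y} : Set X)) : f ∉ setA X := by
  intro hf
  have h1 : IsSmall {y | ¬ IsSmall (f ⁻¹' {y})} := almostAll_iff.1 hf
  refine absurd ((mk_le_mk_of_subset fun y hy => ?_).trans_lt h1) (not_lt.2 hS.ge)
  exact not_lt.2 (h y hy)

theorem not_mem_setG {c : Cardinal.{u}} (hc : 1 ≤ c) {f : Function.End X} {A : Set X}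
    (hA : c ≤ #A) (hf : f '' Aᶜ = Set.univ) : f ∉ setG X c := by
  intro h
  obtain ⟨B, hB, hBc⟩ := le_mk_iff_exists_subset.1 hA
  have h1 := h B hBc
  have h2 : f '' Bᶜ = Set.univ := by
    rw [← Set.univ_subset_iff, ← hf]
    exact Set.image_mono (Set.compl_subset_compl.2 hB)
  rw [h2, Set.compl_univ, mk_eq_zero] at h1
  exact absurd (hc.trans h1) (not_le.2 zero_lt_one)

theorem mem_setG_of_le_corange {c : Cardinal.{u}} {f : Function.End X}
    (hf : c ≤ #((Set.range f)ᶜ : Set X)) : f ∈ setG X c := fun _ _ =>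
  hf.trans (mk_le_mk_of_subset (Set.compl_subset_compl.2 (Set.image_subset_range _ _)))

theorem not_mem_setM_of_injective {c : Cardinal.{u}} (hc : 1 ≤ c) {f : Function.End X}
    (hf : Function.Injective f) (h : c ≤ #((Set.range f)ᶜ : Set X)) : f ∉ setM X c := by
  rintro (h1 | h1)
  · exact absurd h1 (not_lt.2 h)
  · exact h1 ⟨∅, by simpa using zero_lt_one.trans_le hc, hf.injOn⟩

variable [Infinite X]

/-- The projection `X × X → X`. -/
theorem exists_surjective_large_fibers (X : Type u) [Infinite X] :
    ∃ f : X → X, Function.Surjective f ∧ ∀ y, #(f ⁻¹' {y} : Set X) = #X := by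
  obtain ⟨e⟩ := exists_prodEquiv X
  refine ⟨fun x => (e x).1, fun y => ⟨e.symm (y, y), by simp⟩, fun y => le_antisymm (mk_set_le _) ?_⟩
  refine mk_le_of_injective (f := fun x => ⟨e.symm (y, x), by simp⟩) fun a b h => ?_
  simpa using h

/-- The folding map `X ⊕ X → X`: a surjection with fibres of size two which remains surjective
when a set of full size is deleted. -/
theorem exists_fold (X : Type u) [Infinite X] :
    ∃ f : X → X, (∀ y, #(f ⁻¹' {y} : Set X) ≤ 2) ∧ ∃ A : Set X, #A = #X ∧ f '' Aᶜ = Set.univ := by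
  obtain ⟨e⟩ := exists_sumEquiv X
  refine ⟨fun x => Sum.elim id id (e x), fun y => ?_, Set.range fun x => e.symm (Sum.inl x), ?_, ?_⟩
  · refine (mk_le_mk_of_subset (t := {e.symm (Sum.inl y), e.symm (Sum.inr y)}) ?_).trans ?_
    · intro x hx
      rcases h : e x with z | z
      · left
        have : z = y := by simpa [h] using hx
        rw [← this, ← h, e.symm_apply_apply]
      · right
        have : z = y := by simpa [h] using hx
        rw [Set.mem_singleton_iff, ← this, ← h, e.symm_apply_apply]
    · refine mk_insert_le.trans ?_
      rw [mk_singleton, one_add_one_eq_two]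
  · exact mk_range_eq _ (e.symm.injective.comp Sum.inl_injective)
  · rw [Set.eq_univ_iff_forall]
    intro y
    refine ⟨e.symm (Sum.inr y), ?_, by simp⟩
    rintro ⟨x, hx⟩
    simp at hx

theorem exists_mem_setA'_not_mem_setG {c : Cardinal.{u}} (hc : 1 ≤ c) (hcX : c ≤ #X) :
    ∃ f ∈ setA' X, f ∉ setG X c ∧ ∀ d, 1 ≤ d → f ∈ setM X d := by
  obtain ⟨f, hf, A, hA, hfA⟩ := exists_fold X
  refine ⟨f, mem_setA'_of_fiber_le 2 (by simpa using hf),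
    not_mem_setG hc (hcX.trans hA.ge) hfA, fun d hd => mem_setM_of_surjective hd ?_⟩
  intro y
  obtain ⟨x, -, hx⟩ := hfA.ge (Set.mem_univ y)
  exact ⟨x, hx⟩

theorem exists_mem_setA'_not_mem_setM {c : Cardinal.{u}} (hc : 1 ≤ c) (hcX : c ≤ #X) :
    ∃ f ∈ setA' X, f ∉ setM X c ∧ ∀ d ≤ #X, f ∈ setG X d := by
  obtain ⟨f, hf, h⟩ := exists_injective_mk_compl_range_eq (le_refl #X)
  exact ⟨f, mem_setA'_of_injective hf, not_mem_setM_of_injective hc hf (hcX.trans h.ge),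
    fun d hd => mem_setG_of_le_corange (hd.trans h.ge)⟩

theorem exists_mem_setM_not_mem_setA (X : Type u) [Infinite X] :
    ∃ f, f ∉ setA X ∧ ∀ d, 1 ≤ d → f ∈ setM X d := by
  obtain ⟨f, hf, h⟩ := exists_surjective_large_fibers X
  exact ⟨f, not_mem_setA (S := Set.univ) mk_univ fun y _ => (h y).ge,
    fun d hd => mem_setM_of_surjective hd hf⟩

theorem exists_mem_setG_not_mem_setA (X : Type u) [Infinite X] :
    ∃ f, f ∉ setA X ∧ ∀ d ≤ #X, f ∈ setG X d := by
  obtain ⟨f, hf, h⟩ := exists_surjective_large_fibers X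
  obtain ⟨i, hi, hi'⟩ := exists_injective_mk_compl_range_eq (le_refl #X)
  refine ⟨i ∘ f, not_mem_setA (S := Set.range i) (mk_range_eq _ hi) ?_,
    fun d hd => mem_setG_of_le_corange (hd.trans (hi'.ge.trans (mk_le_mk_of_subset ?_)))⟩
  · rintro _ ⟨y, rfl⟩
    rw [← h y]
    refine mk_le_mk_of_subset fun x hx => ?_
    exact congrArg i hx
  · exact Set.compl_subset_compl.2 (Set.range_comp_subset_range _ _)

/-- Delete a set `A` of size `d`, map the rest bijectively onto the complement of a set `B` of size
`b`, and collapse `A` to a point outside `B`. -/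
theorem exists_collapse {b d : Cardinal.{u}} (hb : b ≤ #X) (hd : d ≤ #X) :
    ∃ (f : X → X) (A B : Set X), #A = d ∧ #B = b ∧ f '' Aᶜ = Bᶜ ∧
      Set.InjOn f Aᶜ ∧ ∃ c ∉ B, ∀ a ∈ A, f a = c := by
  classical
  obtain ⟨A, hA, hA'⟩ := exists_set_mk_eq hd
  obtain ⟨B, hB, hB'⟩ := exists_set_mk_eq hb
  obtain ⟨e⟩ := Cardinal.eq.1 (hA'.trans hB'.symm)
  have : Nonempty ↥Bᶜ := by
    rw [← mk_ne_zero_iff, hB']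
    exact mk_ne_zero X
  obtain ⟨c⟩ := this
  let f : X → X := fun x => if h : x ∈ A then c else e ⟨x, h⟩
  have hf : ∀ x (h : x ∈ Aᶜ), f x = e ⟨x, h⟩ := fun x h => dif_neg h
  refine ⟨f, A, B, hA, hB, ?_, ?_, c, c.2, fun a ha => dif_pos ha⟩
  · ext y
    constructor
    · rintro ⟨x, hx, rfl⟩
      rw [hf x hx]
      exact (e _).2
    · intro hy
      exact ⟨e.symm ⟨y, hy⟩, (e.symm _).2, by rw [hf _ (e.symm _).2]; simp⟩
  · intro x hx y hy hxy
    rw [hf x hx, hf y hy] at hxy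
    exact congrArg Subtype.val (e.injective (Subtype.ext hxy))

theorem exists_mem_setG_not_mem_setG {c d : Cardinal.{u}} (hc : IsListedIndex X c)
    (hd : IsListedIndex X d) (hne : c ≠ d) : ∃ f ∈ setG X c, f ∉ setG X d := by
  have hcX := hc.le_mk
  have hdX := hd.le_mk
  rcases hne.lt_or_gt with h | h
  · -- a map whose range already misses `c` points
    obtain ⟨f, A, B, hA, hB, him, -, p, hp, hfA⟩ := exists_collapse hcX hdX
    refine ⟨f, mem_setG_of_le_corange ?_, fun hf => ?_⟩
    · rw [← hB]
      refine mk_le_mk_of_subset fun y hy hy' => ?_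
      obtain ⟨x, rfl⟩ := hy'
      by_cases hx : x ∈ A
      · rw [hfA x hx] at hy
        exact hp hy
      · exact him.le ⟨x, hx, rfl⟩ hy
    · have := hf A hA
      rw [him, compl_compl, hB] at this
      exact absurd h (not_lt.2 this)
  · -- a surjection which collapses only `d` points, so that deleting `c > d` points matters
    obtain ⟨f, A, B, hA, hB, him, hinj, p, -, hfA⟩ :=
      exists_collapse (b := 0) (zero_le (a := #X)) hdX
    have hd1 := hd.one_le
    have hc0 : ℵ₀ ≤ c := by
      rcases hc with rfl | hc
      · exact absurd h (not_lt.2 hd1)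
      · exact hc.1
    rw [mk_set_eq_zero_iff] at hB
    refine ⟨f, fun C hC => ?_, not_mem_setG hd1 hA.ge (by simpa [hB] using him)⟩
    have h1 : f '' (C \ A) ⊆ (f '' Cᶜ)ᶜ ∪ {p} := by
      rintro _ ⟨x, ⟨hxC, hxA⟩, rfl⟩
      by_contra hcon
      rw [Set.mem_union, not_or, Set.notMem_compl_iff] at hcon
      obtain ⟨⟨y, hy, hyx⟩, hne'⟩ := hcon
      by_cases hyA : y ∈ A
      · exact hne' (by rw [← hyx, hfA y hyA]; rfl)
      · exact hy (hinj hyA hxA hyx ▸ hxC)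
    have h2 : c ≤ #(C \ A : Set X) := by
      by_contra hcon
      have : #(C \ A ∪ A : Set X) < c :=
        mk_union_lt_of_infinite_or_one (Or.inr hc0) (not_le.1 hcon) (hA.trans_lt h)
      refine absurd ((mk_le_mk_of_subset ?_).trans_lt this) (not_lt.2 hC.ge)
      simp
    by_contra hcon
    have h3 : #((f '' Cᶜ)ᶜ ∪ {p} : Set X) < c :=
      mk_union_lt_of_infinite_or_one (Or.inr hc0) (not_le.1 hcon)
        (by rw [mk_singleton]; exact one_lt_aleph0.trans_le hc0)
    have h4 : #(f '' (C \ A)) = #(C \ A : Set X) :=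
      mk_image_eq_of_injOn _ _ (hinj.mono fun x hx => hx.2)
    exact absurd ((mk_le_mk_of_subset h1).trans_lt h3) (not_lt.2 (h2.trans h4.ge))

/-- Glue two disjoint copies of a set of size `d` together. -/
theorem exists_gluing {d : Cardinal.{u}} (hd : d ≤ #X) :
    ∃ r : X → X, (∃ A : Set X, #A = d ∧ Set.InjOn r Aᶜ) ∧
      ∀ C : Set X, Set.InjOn r Cᶜ → d ≤ #C := by
  classical
  obtain ⟨A, hA, hA'⟩ := exists_set_mk_eq hd
  obtain ⟨i⟩ : Nonempty (A ↪ ↥Aᶜ) := by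
    have h : #A ≤ #(Aᶜ : Set X) := by rw [hA, hA']; exact hd
    exact h
  let r : X → X := fun x => if h : x ∈ A then i ⟨x, h⟩ else x
  have hr : ∀ x ∈ Aᶜ, r x = x := fun x h => dif_neg h
  have hr' : ∀ x : A, r x = i x := fun x => dif_pos x.2
  refine ⟨r, ⟨A, hA, fun x hx y hy h => by rwa [hr x hx, hr y hy] at h⟩, fun C hC => ?_⟩
  rw [← hA]
  have key : ∀ a : A, (a : X) ∈ C ∨ (i a : X) ∈ C := by
    intro a
    by_contra! hcon
    have := hC hcon.1 hcon.2 (by rw [hr', hr _ (i a).2])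
    exact (i a).2 (this ▸ a.2)
  refine mk_le_of_injective
    (f := fun a : A => if h : (a : X) ∈ C then (⟨a, h⟩ : C) else ⟨i a, (key a).resolve_left h⟩) ?_
  intro a b hab
  by_cases ha : (a : X) ∈ C <;> by_cases hb : (b : X) ∈ C <;>
    simp only [ha, hb, dif_pos, dif_neg, not_false_eq_true, Subtype.mk.injEq] at hab
  · exact Subtype.ext hab
  · exact absurd (hab ▸ a.2) (i b).2
  · exact absurd (hab ▸ b.2) (i a).2
  · exact i.injective (Subtype.ext hab)

theorem exists_mem_setM_not_mem_setM {c d : Cardinal.{u}} (hc : IsListedIndex X c)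
    (hd : IsListedIndex X d) (hne : c ≠ d) : ∃ f ∈ setM X c, f ∉ setM X d := by
  have hcX := hc.le_mk
  have hdX := hd.le_mk
  rcases hne.lt_or_gt with h | h
  · -- a `d`-injective map missing many points, but gluing too many points to be `c`-injective
    obtain ⟨r, ⟨A, hA, hrA⟩, hr⟩ := exists_gluing hcX
    obtain ⟨j, hj, hj'⟩ := exists_injective_mk_compl_range_eq (le_refl #X)
    refine ⟨j ∘ r, Or.inr ?_, ?_⟩
    · rintro ⟨C, hC, hinj⟩
      exact absurd hC (not_lt.2 (hr C fun x hx y hy hxy => hinj hx hy (congrArg j hxy)))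
    · rintro (h1 | h1)
      · refine absurd h1 (not_lt.2 (hdX.trans (hj'.ge.trans (mk_le_mk_of_subset ?_))))
        exact Set.compl_subset_compl.2 (Set.range_comp_subset_range _ _)
      · exact h1 ⟨A, hA.trans_lt h, hj.comp_injOn hrA⟩
  · obtain ⟨f, hf, hf'⟩ := exists_injective_mk_compl_range_eq hdX
    exact ⟨f, Or.inl (hf'.trans_lt h), not_mem_setM_of_injective
      (hd.one_le) hf hf'.ge⟩

theorem setG_not_subset_setA {c : Cardinal.{u}} (hc : IsListedIndex X c) :
    ¬ setG X c ⊆ setA X := fun h =>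
  let ⟨_, hf', hf⟩ := exists_mem_setG_not_mem_setA X
  hf' (h (hf c hc.le_mk))

theorem setM_not_subset_setA {c : Cardinal.{u}} (hc : IsListedIndex X c) :
    ¬ setM X c ⊆ setA X := fun h =>
  let ⟨_, hf', hf⟩ := exists_mem_setM_not_mem_setA X
  hf' (h (hf c hc.one_le))

theorem setA'_not_subset_setG {c : Cardinal.{u}} (hc : IsListedIndex X c) :
    ¬ setA' X ⊆ setG X c := fun h =>
  let ⟨_, hf, hf', _⟩ := exists_mem_setA'_not_mem_setG hc.one_le hc.le_mk
  hf' (h hf)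

theorem setA'_not_subset_setM {c : Cardinal.{u}} (hc : IsListedIndex X c) :
    ¬ setA' X ⊆ setM X c := fun h =>
  let ⟨_, hf, hf', _⟩ := exists_mem_setA'_not_mem_setM hc.one_le hc.le_mk
  hf' (h hf)

theorem setG_not_subset_setM {c d : Cardinal.{u}} (hc : IsListedIndex X c)
    (hd : IsListedIndex X d) : ¬ setG X c ⊆ setM X d := fun h =>
  let ⟨_, _, hf', hf⟩ := exists_mem_setA'_not_mem_setM hd.one_le hd.le_mk
  hf' (h (hf c hc.le_mk))

theorem setM_not_subset_setG {c d : Cardinal.{u}} (hc : IsListedIndex X c)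
    (hd : IsListedIndex X d) : ¬ setM X c ⊆ setG X d := fun h =>
  let ⟨_, _, hf', hf⟩ := exists_mem_setA'_not_mem_setG hd.one_le hd.le_mk
  hf' (h (hf c hc.one_le))

theorem IsListed.eq_of_subset {S T : Set (Function.End X)} (hS : IsListed S) (hT : IsListed T)
    (h : S ⊆ T) : S = T := by
  rcases hS with ⟨hreg, rfl⟩ | ⟨hsing, rfl⟩ | ⟨c, hc, rfl | rfl⟩ <;>
    rcases hT with ⟨hreg', rfl⟩ | ⟨hsing', rfl⟩ | ⟨d, hd, rfl | rfl⟩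
  · rfl
  · exact absurd hreg hsing'.not_isRegular
  · exact absurd (setA'_subset_setA.trans h) (setA'_not_subset_setG hd)
  · exact absurd (setA'_subset_setA.trans h) (setA'_not_subset_setM hd)
  · exact absurd hreg' hsing.not_isRegular
  · rfl
  · exact absurd h (setA'_not_subset_setG hd)
  · exact absurd h (setA'_not_subset_setM hd)
  · exact absurd h (setG_not_subset_setA hc)
  · exact absurd (h.trans setA'_subset_setA) (setG_not_subset_setA hc)
  · by_contra hne
    obtain ⟨f, hf, hf'⟩ := exists_mem_setG_not_mem_setG hc hd fun hcd => hne (by rw [hcd])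
    exact hf' (h hf)
  · exact absurd h (setG_not_subset_setM hc hd)
  · exact absurd h (setM_not_subset_setA hc)
  · exact absurd (h.trans setA'_subset_setA) (setM_not_subset_setA hc)
  · exact absurd h (setM_not_subset_setG hc hd)
  · by_contra hne
    obtain ⟨f, hf, hf'⟩ := exists_mem_setM_not_mem_setM hc hd fun hcd => hne (by rw [hcd])
    exact hf' (h hf)

theorem IsListed.ne_univ {S : Set (Function.End X)} (hS : IsListed S) : S ≠ Set.univ := by
  intro h
  have sub : ∀ T : Set (Function.End X), T ⊆ S := fun T => h ▸ Set.subset_univ T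
  have h1 : IsListedIndex X 1 := Or.inl rfl
  rcases hS with ⟨-, rfl⟩ | ⟨-, rfl⟩ | ⟨c, hc, rfl | rfl⟩
  · exact setG_not_subset_setA h1 (sub _)
  · exact setG_not_subset_setA h1 ((sub _).trans setA'_subset_setA)
  · exact setA'_not_subset_setG hc (sub _)
  · exact setA'_not_subset_setM hc (sub _)

end

/-! ### A monoid contained in no listed set contains everything -/

section
variable {X : Type u} {H : Submonoid (Function.End X)}

theorem mul_mem_of_perm (hP : permSet X ⊆ H) {f g : Function.End X} (hf : f ∈ H) (hg : g ∈ H)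
    (e : Equiv.Perm X) : (fun x => f (e (g x)) : Function.End X) ∈ H :=
  H.mul_mem hf (H.mul_mem (hP (show (e : X → X) ∈ permSet X from e.bijective)) hg)

/-- A family of points avoiding all fibres of `h` over a set `D` of values of `h` omits at least `#D`
points. -/
theorem mk_le_mk_compl_range {T : Type u} {h : X → X} {D : Set X} (hD : D ⊆ Set.range h)
    {z : T → X} (hz : ∀ t, h (z t) ∉ D) : #D ≤ #((Set.range z)ᶜ : Set X) := by
  choose x hx using fun y : D => hD y.2
  refine mk_le_of_injective (f := fun y => ⟨x y, ?_⟩) fun a b hab => ?_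
  · rintro ⟨t, ht⟩
    refine hz t ?_
    rw [ht, hx]
    exact y.2
  · rw [Subtype.mk.injEq] at hab
    exact Subtype.ext (by rw [← hx a, ← hx b, hab])

theorem exists_surjective_mem_nat (hG : ∃ g ∈ H, g ∉ setG X 1) (n : ℕ) :
    ∃ f ∈ H, ∃ A : Set X, #A = n ∧ f '' Aᶜ = Set.univ := by
  obtain ⟨g, hgH, hg⟩ := hG
  rw [setG, Set.mem_ofPred_eq] at hg
  push Not at hg
  obtain ⟨B, hB, hgB⟩ := hg
  rw [Cardinal.lt_one_iff, mk_set_eq_zero_iff, Set.compl_empty_iff] at hgB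
  obtain ⟨a, rfl⟩ := mk_set_eq_one_iff.1 hB
  induction n with
  | zero => exact ⟨1, H.one_mem, ∅, by simp, by
    rw [Set.compl_empty]
    exact Set.image_id _⟩
  | succ n ih =>
    obtain ⟨f, hf, A, hA, hfA⟩ := ih
    obtain ⟨b, hbA, hb⟩ := hfA.ge (Set.mem_univ a)
    refine ⟨g * f, H.mul_mem hgH hf, insert b A, ?_, ?_⟩
    · rw [mk_insert hbA, hA, Nat.cast_succ]
    · rw [Set.eq_univ_iff_forall]
      intro y
      obtain ⟨x, hx, rfl⟩ := hgB.ge (Set.mem_univ y)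
      obtain ⟨z, hz, rfl⟩ := hfA.ge (Set.mem_univ x)
      refine ⟨z, ?_, rfl⟩
      rintro (rfl | h)
      · exact hx hb
      · exact hz h

theorem exists_injective_mem_nat (hM : ∃ g ∈ H, g ∉ setM X 1) (n : ℕ) :
    ∃ p ∈ H, Function.Injective p ∧ (n : Cardinal.{u}) ≤ #((Set.range p)ᶜ : Set X) := by
  obtain ⟨g, hgH, hg⟩ := hM
  obtain ⟨hg1, hg2⟩ := not_or.1 hg
  obtain ⟨A, hA, hinj⟩ := not_not.1 hg2
  rw [Cardinal.lt_one_iff, mk_set_eq_zero_iff] at hA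
  subst hA
  have hinj : Function.Injective g := fun x y h =>
    hinj (Set.notMem_empty x) (Set.notMem_empty y) h
  obtain ⟨b, hb⟩ : ((Set.range g)ᶜ).Nonempty := by
    rw [Set.nonempty_iff_ne_empty, ne_eq, ← mk_set_eq_zero_iff, ← Cardinal.lt_one_iff]
    exact hg1
  induction n with
  | zero => exact ⟨1, H.one_mem, fun _ _ h => h, by simp⟩
  | succ n ih =>
    obtain ⟨p, hp, hpi, hn⟩ := ih
    refine ⟨g * p, H.mul_mem hgH hp, hinj.comp hpi, ?_⟩
    have h1 : g '' (Set.range p)ᶜ ∪ {b} ⊆ (Set.range (g * p))ᶜ := by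
      rintro y (⟨x, hx, rfl⟩ | rfl) ⟨z, hz⟩
      · exact hx ⟨z, hinj hz⟩
      · exact hb ⟨p z, hz⟩
    refine le_trans ?_ (mk_le_mk_of_subset h1)
    rw [mk_union_of_disjoint, mk_image_eq hinj, mk_singleton, Nat.cast_succ]
    · exact add_le_add hn le_rfl
    · rw [Set.disjoint_singleton_right]
      rintro ⟨x, -, hx⟩
      exact hb ⟨x, hx⟩

variable [Infinite X]

/-- A monoid contained in no `ℳ_c` contains injections missing as many points as desired. A map in
the monoid that misses `c` points and is injective off a set `A` with `#A < c` becomes injective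
when it is preceded by an injection whose range avoids `A`, and such an injection is provided by
induction. -/
theorem exists_injective_mem (hP : permSet X ⊆ H)
    (hM : ∀ c, IsListedIndex X c → ∃ g ∈ H, g ∉ setM X c) (c : Cardinal.{u}) (hc : c ≤ #X) :
    ∃ p ∈ H, Function.Injective p ∧ c ≤ #((Set.range p)ᶜ : Set X) := by
  induction c using WellFoundedLT.induction with | ind c ih
  by_cases hfin : c < ℵ₀
  · obtain ⟨n, rfl⟩ := lt_aleph0.1 hfin
    exact exists_injective_mem_nat (hM 1 (Or.inl rfl)) n
  obtain ⟨g, hgH, hg⟩ := hM c (Or.inr ⟨not_lt.1 hfin, hc⟩)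
  obtain ⟨hg1, hg2⟩ := not_or.1 hg
  obtain ⟨A, hA, hinj⟩ := not_not.1 hg2
  obtain ⟨i, hiH, hi, hAi⟩ := ih #A hA (hA.le.trans hc)
  obtain ⟨C, hC, hCA⟩ := le_mk_iff_exists_subset.1 hAi
  obtain ⟨e, rfl⟩ := exists_perm_image_eq hCA
    (mk_compl_eq_mk_compl_infinite (hCA.trans_lt (hA.trans_le hc)) (hA.trans_le hc))
  have hav : ∀ x, e (i x) ∈ (e '' C)ᶜ := by
    rintro x ⟨y, hy, hyx⟩
    exact hC hy ⟨x, (e.injective hyx).symm⟩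
  refine ⟨_, mul_mem_of_perm hP hgH hiH e, fun x y hxy => ?_, ?_⟩
  · exact hi (e.injective (hinj (hav x) (hav y) hxy))
  · refine (not_lt.1 hg1).trans (mk_le_mk_of_subset (Set.compl_subset_compl.2 ?_))
    rintro _ ⟨x, rfl⟩
    exact ⟨_, rfl⟩

theorem mem_of_injective (hP : permSet X ⊆ H)
    (hM : ∀ c, IsListedIndex X c → ∃ g ∈ H, g ∉ setM X c) {q : Function.End X}
    (hq : Function.Injective q) (hq' : #X ≤ #((Set.range q)ᶜ : Set X)) : q ∈ H := by
  obtain ⟨p, hpH, hp, hp'⟩ := exists_injective_mem hP hM #X le_rfl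
  obtain ⟨e, he⟩ := exists_equiv_comp_eq p q hp hq
    (((mk_set_le _).antisymm hp').trans ((mk_set_le _).antisymm hq').symm)
  have : q = fun x => e (p x) := funext fun x => (he x).symm
  rw [this]
  exact mul_mem_of_perm hP H.one_mem hpH e

/-- A monoid contained in no `𝒢_c` contains maps which stay surjective when as many points as
desired are deleted: the fewer than `c` points missed by a map outside `𝒢_c` can be moved into a
set that is redundant for another map of the monoid, provided by induction. -/
theorem exists_surjective_mem (hP : permSet X ⊆ H)
    (hG : ∀ c, IsListedIndex X c → ∃ g ∈ H, g ∉ setG X c) (c : Cardinal.{u}) (hc : c ≤ #X) :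
    ∃ f ∈ H, ∃ A : Set X, #A = c ∧ f '' Aᶜ = Set.univ := by
  induction c using WellFoundedLT.induction with | ind c ih
  by_cases hfin : c < ℵ₀
  · obtain ⟨n, rfl⟩ := lt_aleph0.1 hfin
    exact exists_surjective_mem_nat (hG 1 (Or.inl rfl)) n
  obtain ⟨g, hgH, hg⟩ := hG c (Or.inr ⟨not_lt.1 hfin, hc⟩)
  rw [setG, Set.mem_ofPred_eq] at hg
  push Not at hg
  obtain ⟨A, hA, hgA⟩ := hg
  obtain ⟨f, hfH, C, hC, hfC⟩ := ih _ hgA (hgA.le.trans hc)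
  obtain ⟨e, he⟩ := exists_perm_image_eq hC.symm
    (mk_compl_eq_mk_compl_infinite (hgA.trans_le hc) (hC.trans_lt (hgA.trans_le hc)))
  refine ⟨_, mul_mem_of_perm hP hfH hgH e, A, hA, ?_⟩
  rw [Set.eq_univ_iff_forall]
  intro y
  obtain ⟨x, hx, rfl⟩ := hfC.ge (Set.mem_univ y)
  have hx' : e.symm x ∈ g '' Aᶜ := by
    by_contra hcon
    exact hx (he.le ⟨e.symm x, hcon, by simp⟩)
  obtain ⟨z, hz, hzx⟩ := hx'
  exact ⟨z, hz, by simp [hzx]⟩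

/-- Given `u`, choose a section `s` of a map `f` as in `exists_surjective_mem`, and match its values
with points `b y` at which `h` has large fibres. There is room to choose an injection `p` with
`h (p x) = b (u x)`, so that `u` is the composition of `p`, `h`, the matching and `f`. -/
theorem mem_of_not_subset_setA (hP : permSet X ⊆ H)
    (hM : ∀ c, IsListedIndex X c → ∃ g ∈ H, g ∉ setM X c)
    (hG : ∀ c, IsListedIndex X c → ∃ g ∈ H, g ∉ setG X c)
    (hA : ∃ h ∈ H, h ∉ setA X) (u : Function.End X) : u ∈ H := by
  obtain ⟨f, hfH, A, hAX, hfA⟩ := exists_surjective_mem hP hG #X le_rfl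
  obtain ⟨h, hhH, hh⟩ := hA
  have hB := mk_eq_of_not_isSmall (fun hs => hh (almostAll_iff.2 hs))
  obtain ⟨b, hb, hbB, hb'⟩ := exists_injective_range_subset hB
  have hbc : #((Set.range b)ᶜ : Set X) = #X :=
    (mk_set_le _).antisymm (hb'.ge.trans (mk_le_mk_of_subset fun x hx => hx.2))
  choose s hsA hs using fun y => hfA.ge (Set.mem_univ y)
  have hsi : Function.Injective s := fun x y hxy => by rw [← hs x, ← hs y, hxy]
  have hsc : #((Set.range s)ᶜ : Set X) = #X := by
    refine (mk_set_le _).antisymm (hAX.ge.trans (mk_le_mk_of_subset ?_))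
    rintro x hx ⟨y, rfl⟩
    exact hsA y hx
  obtain ⟨e, he⟩ := exists_equiv_comp_eq b s hb hsi (hbc.trans hsc.symm)
  have hk : ∀ y, Nonempty (X ↪ ↥(h ⁻¹' {b y})) := fun y => not_lt.1 (hbB y)
  let k := fun y => (hk y).some
  let p : Function.End X := fun x => k (u x) x
  have hp : ∀ x, h (p x) = b (u x) := fun x => (k (u x) x).2
  have hpi : Function.Injective p := by
    intro x y hxy
    have h1 : u x = u y := hb (by rw [← hp, ← hp, hxy])
    simp only [p] at hxy
    rw [h1] at hxy
    exact (k (u y)).injective (Subtype.ext hxy)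
  have hpc : #X ≤ #((Set.range p)ᶜ : Set X) := by
    rw [← hb']
    refine mk_le_mk_compl_range (h := h) (fun y hy => ?_) fun x hx => hx.2 ⟨u x, (hp x).symm⟩
    by_contra hcon
    refine hy.1 ?_
    rw [IsSmall, Set.preimage_singleton_eq_empty.2 hcon, mk_eq_zero, pos_iff_ne_zero]
    exact mk_ne_zero X
  have hpH : p ∈ H := mem_of_injective hP hM hpi hpc
  have hu : u = fun x => f (e ((h * p) x)) := by
    funext x
    change u x = f (e (h (p x)))
    rw [hp, he, hs]
  rw [hu]
  exact mul_mem_of_perm hP hfH (H.mul_mem hhH hpH) e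

/-- If `#X` is singular and `h ∉ 𝒜'`, then for a suitable permutation `e` the map `h ∘ e ∘ h` has
`#X` fibres of full size. For a family `l i` of fewer than `#X` cardinals cofinal in `#X`, there are
points `y (j, i)` whose fibres have more than `l i` elements, and `e` moves the `y (j, i)`, `i`
varying, into one fibre of `h`. -/
theorem exists_not_mem_setA (hsing : (#X).IsSingular) (hP : permSet X ⊆ H)
    (hA : ∃ h ∈ H, h ∉ setA' X) : ∃ h ∈ H, h ∉ setA X := by
  obtain ⟨h, hhH, hh⟩ := hA
  obtain ⟨ι, l, hι, hl, hcof⟩ := exists_cofinal_family hsing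
  have hbig : ∀ c < #X, #{y | c < #(h ⁻¹' {y} : Set X)} = #X := by
    intro c hc
    refine mk_eq_of_not_isSmall fun hs => hh ⟨c, hc, almostAll_iff.2 ?_⟩
    simpa only [not_le] using hs
  obtain ⟨w, hw, hwB, hwc⟩ := exists_injective_range_subset (hbig #ι hι)
  have hk : ∀ j, Nonempty (ι ↪ ↥(h ⁻¹' {w j})) := fun j =>
    (show #ι ≤ #(h ⁻¹' {w j} : Set X) from (hwB j).le)
  let z : X × ι → X := fun t => (hk t.1).some t.2
  have hz : ∀ t, h (z t) = w t.1 := fun t => ((hk t.1).some t.2).2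
  have hzi : Function.Injective z := by
    rintro ⟨j, i⟩ ⟨j', i'⟩ hjj
    have h1 : j = j' := hw (by rw [← hz (j, i), ← hz (j', i'), hjj])
    subst h1
    exact congrArg (Prod.mk j) ((hk j).some.injective (Subtype.ext hjj))
  have hzc : #((Set.range z)ᶜ : Set X) = #X := by
    refine (mk_set_le _).antisymm ?_
    conv_lhs => rw [← hwc]
    refine mk_le_mk_compl_range (h := h) (fun y hy => ?_) fun t ht => ht.2 ⟨t.1, (hz t).symm⟩
    by_contra hcon
    have h1 : #ι < #(h ⁻¹' {y} : Set X) := hy.1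
    rw [Set.preimage_singleton_eq_empty.2 hcon, mk_eq_zero (∅ : Set X)] at h1
    exact not_lt_bot h1
  -- the summand `X` of the index type reserves room for the complement of the points `y (j, i)`
  obtain ⟨y, hy, hyB⟩ := exists_injective_choice (X := X) (T := (X × ι) ⊕ X)
    (by
      rw [mk_sum, mk_prod, lift_id, lift_id, lift_id]
      exact add_le_of_le (aleph0_le_mk X) (mul_le_of_le (aleph0_le_mk X) le_rfl hι.le) le_rfl)
    (Sum.elim (fun t => {y | l t.2 < #(h ⁻¹' {y} : Set X)}) fun _ => Set.univ)
    (by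
      rintro (t | t)
      · exact hbig _ (hl t.2)
      · exact mk_univ)
  have hyc : #((Set.range fun t => y (Sum.inl t))ᶜ : Set X) = #X := by
    refine (mk_set_le _).antisymm
      (mk_le_of_injective (f := fun x => ⟨y (Sum.inr x), ?_⟩) fun a b hab => ?_)
    · rintro ⟨t, ht⟩
      exact Sum.inl_ne_inr (hy ht)
    · rw [Subtype.mk.injEq] at hab
      exact Sum.inr_injective (hy hab)
  obtain ⟨e, he⟩ := exists_equiv_comp_eq (fun t => y (Sum.inl t)) z (hy.comp Sum.inl_injective) hzi
    (hyc.trans hzc.symm)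
  refine ⟨_, mul_mem_of_perm hP hhH hhH e, not_mem_setA (S := Set.range w) (mk_range_eq w hw) ?_⟩
  rintro _ ⟨j, rfl⟩
  by_contra hcon
  obtain ⟨i, hi⟩ := hcof _ (not_le.1 hcon)
  refine absurd (hi.trans_lt (hyB (Sum.inl (j, i)))) (not_lt.2 (mk_le_mk_of_subset ?_))
  intro x hx
  have hx : h x = y (Sum.inl (j, i)) := hx
  change h (e (h x)) = w j
  rw [hx, he, hz]

theorem eq_top_of_not_subset_isListed (hP : permSet X ⊆ H)
    (hH : ∀ S, IsListed S → ¬ (H : Set (Function.End X)) ⊆ S) : H = ⊤ := by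
  have hex : ∀ S, IsListed S → ∃ g ∈ H, g ∉ S := fun S hS => Set.not_subset.1 (hH S hS)
  have hM : ∀ c, IsListedIndex X c → ∃ g ∈ H, g ∉ setM X c := fun c hc =>
    hex _ (Or.inr (Or.inr ⟨c, hc, Or.inr rfl⟩))
  have hG : ∀ c, IsListedIndex X c → ∃ g ∈ H, g ∉ setG X c := fun c hc =>
    hex _ (Or.inr (Or.inr ⟨c, hc, Or.inl rfl⟩))
  have hA : ∃ h ∈ H, h ∉ setA X := by
    rcases isRegular_or_isSingular (aleph0_le_mk X) with hreg | hsing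
    · exact hex _ (Or.inl ⟨hreg, rfl⟩)
    · exact exists_not_mem_setA hsing hP (hex _ (Or.inr (Or.inl ⟨hsing, rfl⟩)))
  exact (Submonoid.eq_top_iff' H).2 (mem_of_not_subset_setA hP hM hG hA)

theorem isListed_iff_isPrecompleteMonoid {S : Set (Function.End X)} :
    IsListed S ↔ IsPrecompleteMonoid S ∧ permSet X ⊆ S := by
  constructor
  · intro hS
    obtain ⟨H, rfl⟩ := hS.exists_submonoid
    refine ⟨⟨H, rfl, fun h => hS.ne_univ (by rw [h]; rfl), fun K hK => ?_⟩, hS.permSet_subset⟩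
    refine eq_top_of_not_subset_isListed (subset_trans hS.permSet_subset hK.le) fun T hT hKT => ?_
    have h1 := hS.eq_of_subset hT (subset_trans hK.le hKT)
    exact hK.not_ge (by rw [← SetLike.coe_subset_coe, h1]; exact hKT)
  · rintro ⟨⟨H, rfl, hH⟩, hP⟩
    by_contra hcon
    refine hH.1 (eq_top_of_not_subset_isListed hP fun T hT hHT => hcon ?_)
    obtain ⟨K, rfl⟩ := hT.exists_submonoid
    rcases hH.le_iff.1 (show H ≤ K from hHT) with h | h
    · exact absurd (by rw [h]; rfl) hT.ne_univ
    · rwa [← h]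

end

/-! ### Symmetric precomplete monoids contain all permutations -/

section
variable {X : Type u}

/-- The inclusion of the group of permutations into the full transformation monoid. -/
def permEnd (X : Type u) : Equiv.Perm X →* Function.End X where
  toFun σ := (σ : X → X)
  map_one' := rfl
  map_mul' _ _ := rfl

/-- If the involution `s` is not in the symmetric coatom `G`, then the maps `f` with `f ∈ G` or
`f * s ∈ G` form a strictly larger submonoid, so they are all maps: `G` behaves like a subgroup of
index two, and the product of two conjugates outside `G` lies in `G`. -/
theorem mul_conj_mem_of_isSymmetric {G : Submonoid (Function.End X)} (hG : IsCoatom G)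
    (hsym : IsSymmetric (G : Set (Function.End X))) {s : Equiv.Perm X} (hs : s * s = 1)
    (τ : Equiv.Perm X) : permEnd X (s * (τ * s * τ⁻¹)) ∈ G := by
  have hconj : ∀ (γ : Equiv.Perm X), ∀ f ∈ G, permEnd X γ⁻¹ * f * permEnd X γ ∈ G := hsym
  by_cases hsG : permEnd X s ∈ G
  · rw [map_mul]
    refine mul_mem hsG ?_
    simpa only [map_mul, inv_inv] using hconj τ⁻¹ _ hsG
  have hsi : s⁻¹ = s := inv_eq_of_mul_eq_one_left hs
  set σ := permEnd X s with hσ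
  have hσσ : σ * σ = 1 := by rw [hσ, ← map_mul, hs, map_one]
  have hσσ' : ∀ f, σ * (σ * f) = f := fun f => by rw [← mul_assoc, hσσ, one_mul]
  have hconj' : ∀ f ∈ G, σ * (f * σ) ∈ G := fun f hf => by
    have h := hconj s f hf
    rwa [hsi, mul_assoc] at h
  let K : Submonoid (Function.End X) :=
    { carrier := {f | f ∈ G ∨ f * σ ∈ G}
      one_mem' := Or.inl G.one_mem
      mul_mem' := by
        rintro f g (hf | hf) (hg | hg)
        · exact Or.inl (G.mul_mem hf hg)
        · right
          rw [mul_assoc]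
          exact G.mul_mem hf hg
        · right
          simpa only [mul_assoc, hσσ'] using G.mul_mem hf (hconj' g hg)
        · left
          simpa only [mul_assoc, hσσ', hσσ, mul_one] using G.mul_mem hf (hconj' _ hg) }
  have hσK : σ ∈ K := Or.inr (hσσ ▸ G.one_mem)
  have hK : K = ⊤ :=
    hG.2 K (lt_of_le_of_ne (fun f hf => Or.inl hf) fun h => hsG (h ▸ hσK))
  have hmem : permEnd X (τ * s * τ⁻¹) ∈ K := hK ▸ Submonoid.mem_top _
  rcases hmem with h | h
  · refine absurd ?_ hsG
    have h1 := hconj τ _ h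
    rw [← map_mul, ← map_mul] at h1
    rwa [show τ⁻¹ * (τ * s * τ⁻¹) * τ = s by group] at h1
  · have h1 := hconj' _ h
    rwa [mul_assoc, hσσ, mul_one, hσ, ← map_mul] at h1

/-- On `ℤ × Y`, an involution `p` of the first coordinate and its conjugate by a family `δ n` of
permutations of the layers `{n} × Y` multiply to a layerwise permutation. With the reflections
`n ↦ -n` and `n ↦ -1 - n` one obtains two layerwise permutations: the first acts as `γ`, `1`, `γ⁻¹`
on the negative, zero and positive layers, the second as `γ⁻¹`, `γ`, `γ`. They cancel except in the
layer `0`. -/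
theorem layer_zero_mem {Y : Type*} (N : Submonoid (Equiv.Perm (ℤ × Y)))
    (hN : ∀ s τ : Equiv.Perm (ℤ × Y), s * s = 1 → s * (τ * s * τ⁻¹) ∈ N) (γ : Equiv.Perm Y) :
    Equiv.prodShear 1 (fun n : ℤ => if n = 0 then γ else 1) ∈ N := by
  have key : ∀ (p : Equiv.Perm ℤ) (hp : ∀ n, p (p n) = n) (δ : ℤ → Equiv.Perm Y),
      Equiv.prodShear 1 (fun n => δ (p n) * (δ n)⁻¹) ∈ N := by
    intro p hp δ
    have h := hN (Equiv.prodShear p fun _ => 1) (Equiv.prodShear 1 δ) (by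
      ext ⟨n, y⟩ <;> simp [hp])
    convert h using 1
    rw [← mul_assoc, ← mul_assoc, eq_mul_inv_iff_mul_eq]
    ext ⟨n, y⟩ <;> simp [hp]
  have h1 := key (Equiv.neg ℤ) (by simp) fun n => if 0 < n then γ else 1
  have h2 := key (Equiv.subLeft (-1)) (by simp) fun n => if n < 0 then γ else 1
  convert N.mul_mem h1 h2 using 1
  ext ⟨n, y⟩
  · simp
  · rcases lt_trichotomy n 0 with h | rfl | h
    · have h3 : ¬ -1 < n := by omega
      have h4 : ¬ 0 < n := by omega
      simp [h, h.ne, h3, h4]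
    · simp
    · have h3 : -1 < n := by omega
      have h4 : ¬ n < 0 := by omega
      simp [h, h.ne', h3, h4]

/-- A permutation fixing `#X` points is an element of the layer zero of a decomposition
`X ≃ ℤ × Y`. -/
theorem mem_of_fixes_large [Infinite X] (N : Submonoid (Equiv.Perm X))
    (hN : ∀ s τ : Equiv.Perm X, s * s = 1 → s * (τ * s * τ⁻¹) ∈ N) (γ : Equiv.Perm X) {R : Set X}
    (hR : #R = #X) (hγ : ∀ x ∈ R, γ x = x) : γ ∈ N := by
  obtain ⟨S, hSR, hS, hRS⟩ := exists_subset_mk_eq hR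
  have hSc : #(Sᶜ : Set X) = #X :=
    (mk_set_le _).antisymm (hRS.ge.trans (mk_le_mk_of_subset fun x hx => hx.2))
  have hinv : ∀ x, γ x ∈ Sᶜ ↔ x ∈ Sᶜ := by
    refine fun x => not_congr ⟨fun h => ?_, fun h => ?_⟩
    · rwa [← γ.injective (hγ _ (hSR h))]
    · rwa [hγ x (hSR h)]
  obtain ⟨e, he⟩ := exists_equiv_comp_eq (fun x : ↥Sᶜ => (x : X))
    (fun x : ↥Sᶜ => ((0 : ℤ), x)) Subtype.val_injective (fun x y h => (Prod.mk.inj h).2) (by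
      rw [Subtype.range_coe, compl_compl, hS]
      refine le_antisymm ?_ ?_
      · rw [← hSc]
        refine mk_le_of_injective (f := fun x => ⟨((1 : ℤ), x), ?_⟩) fun x y h => ?_
        · rintro ⟨y, hy⟩
          simp at hy
        · simpa using h
      · refine (mk_set_le _).trans ?_
        rw [mk_prod, mk_int, lift_aleph0, lift_uzero, hSc]
        exact mul_le_of_le (aleph0_le_mk X) (aleph0_le_mk X) le_rfl)
  have h := layer_zero_mem (N.comap (Equiv.permCongrHom e.symm).toMonoidHom)
    (fun s τ hs => by
      change Equiv.permCongrHom e.symm _ ∈ N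
      rw [map_mul, map_mul, map_mul, map_inv]
      exact hN _ _
        (by
          have h := congrArg (Equiv.permCongrHom e.symm) hs
          rwa [map_mul, map_one] at h)) (γ.subtypePerm hinv)
  have h : e.symm.permCongr _ ∈ N := h
  convert h using 1
  ext x
  by_cases hx : x ∈ Sᶜ
  · have h1 : e x = (0, ⟨x, hx⟩) := he ⟨x, hx⟩
    have h2 := he ⟨γ x, (hinv x).2 hx⟩
    rw [Equiv.permCongr_apply, Equiv.symm_symm, h1, Equiv.eq_symm_apply]
    simpa using h2
  · have h1 : (e x).1 ≠ 0 := by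
      intro h0
      have h2 : e x = e (e x).2 := by
        rw [he (e x).2, ← h0]
      exact hx (e.injective h2 ▸ (e x).2.2)
    rw [Equiv.permCongr_apply, Equiv.symm_symm, Equiv.eq_symm_apply]
    rw [hγ x (hSR (not_not.1 hx))]
    ext <;> simp [h1]

/-- Of two disjoint sets `A`, `B` of size `#X` which leave `#X` points uncovered, one will do: the
images `γ '' A` and `γ '' B` are disjoint and cannot both cover almost all of the rest. -/
theorem exists_moved_set_mk_compl_eq [Infinite X] (γ : Equiv.Perm X) :
    ∃ A : Set X, #A = #X ∧ #((A ∪ γ '' A)ᶜ : Set X) = #X := by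
  obtain ⟨A, hA, hA'⟩ := exists_set_mk_eq (le_refl #X)
  obtain ⟨B, hBA, hB, hB'⟩ := exists_subset_mk_eq hA'
  by_contra! hcon
  have h1 : #((A ∪ γ '' A)ᶜ : Set X) < #X := (mk_set_le _).lt_of_ne (hcon A hA)
  have h2 : #((B ∪ γ '' B)ᶜ : Set X) < #X := (mk_set_le _).lt_of_ne (hcon B hB)
  have h3 := mk_union_lt_of_infinite_or_one (Or.inr (aleph0_le_mk X)) h1 h2
  refine absurd (hB'.ge.trans (mk_le_mk_of_subset fun x hx => ?_)) (not_le.2 h3)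
  -- a point outside `A` and `B` cannot be in both images
  by_contra hx'
  rw [Set.mem_union, not_or, Set.notMem_compl_iff, Set.notMem_compl_iff] at hx'
  obtain ⟨a, ha, rfl⟩ := hx'.1.resolve_left hx.1
  obtain ⟨b, hb, hba⟩ := hx'.2.resolve_left hx.2
  rw [γ.injective hba] at hb
  exact hBA hb ha

theorem permSet_subset_of_isSymmetric [Infinite X] {G : Submonoid (Function.End X)}
    (hG : IsCoatom G) (hsym : IsSymmetric (G : Set (Function.End X))) : permSet X ⊆ G := by
  have hN : ∀ s τ : Equiv.Perm X, s * s = 1 → s * (τ * s * τ⁻¹) ∈ G.comap (permEnd X) :=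
    fun s τ hs => mul_conj_mem_of_isSymmetric hG hsym hs τ
  intro f hf
  let γ : Equiv.Perm X := Equiv.ofBijective f hf
  suffices γ ∈ G.comap (permEnd X) from this
  obtain ⟨A, hA, hC⟩ := exists_moved_set_mk_compl_eq γ
  obtain ⟨R, hRC, hR, hR'⟩ := exists_subset_mk_eq hC
  -- `δ` agrees with `γ` on `A` and fixes `R`, so that `γ = δ * (δ⁻¹ * γ)` with both factors fixing
  -- many points
  obtain ⟨δ, hδ⟩ := exists_equiv_comp_eq (Sum.elim (fun a : A => (a : X)) fun r : R => (r : X))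
    (Sum.elim (fun a : A => γ a) fun r : R => (r : X))
    (Function.Injective.sumElim Subtype.val_injective Subtype.val_injective fun a r h =>
      hRC r.2 (Or.inl (h ▸ a.2)))
    (Function.Injective.sumElim (γ.injective.comp Subtype.val_injective) Subtype.val_injective
      fun a r h => hRC r.2 (Or.inr ⟨a, a.2, h⟩))
    (by
      refine ((mk_set_le _).antisymm (hR'.ge.trans (mk_le_mk_of_subset fun x hx => ?_))).trans
        ((mk_set_le _).antisymm (hR'.ge.trans (mk_le_mk_of_subset fun x hx => ?_))).symm
      · rintro ⟨a | r, rfl⟩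
        · exact hx.1 (Or.inl a.2)
        · exact hx.2 r.2
      · rintro ⟨a | r, rfl⟩
        · exact hx.1 (Or.inr ⟨a, a.2, rfl⟩)
        · exact hx.2 r.2)
  have h1 := mem_of_fixes_large _ hN δ hR fun x hx => hδ (Sum.inr ⟨x, hx⟩)
  have h2 := mem_of_fixes_large _ hN (δ⁻¹ * γ) hA fun x hx => by
    rw [Equiv.Perm.mul_apply, Equiv.Perm.inv_eq_iff_eq]
    exact (hδ (Sum.inl ⟨x, hx⟩)).symm
  simpa using mul_mem h1 h2

theorem isSymmetric_of_permSet_subset {G : Submonoid (Function.End X)} (h : permSet X ⊆ G) :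
    IsSymmetric (G : Set (Function.End X)) := fun γ _ hf =>
  G.mul_mem (h γ.symm.bijective) (G.mul_mem hf (h γ.bijective))

end

theorem theorem6 {X : Type*} [Infinite X] (S : Set (Function.End X)) :
    (IsPrecompleteMonoid S ∧ IsSymmetric S ↔ IsPrecompleteMonoid S ∧ permSet X ⊆ S) ∧
    (IsPrecompleteMonoid S ∧ IsSymmetric S ↔ IsListed S) := by
  have h : IsPrecompleteMonoid S ∧ IsSymmetric S ↔ IsPrecompleteMonoid S ∧ permSet X ⊆ S := by
    refine and_congr_right ?_
    rintro ⟨G, rfl, hG⟩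
    exact ⟨permSet_subset_of_isSymmetric hG, isSymmetric_of_permSet_subset⟩
  exact ⟨h, h.trans isListed_iff_isPrecompleteMonoid.symm⟩
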